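/- Let $G$ be a finite group of order $n$ that is not locally cyclic (i.e. some finitely generated subgroup of $G$ is not cyclic; as $G$ is finite, this means that $G$ is not cyclic). Put $Cyc(G)=\{y\in G : \langle x,y\rangle \text{ is cyclic for all } x\in G\}$ and assume that $|Cyc(G)|=1$. Let $\Gamma_G$ be the simple graph with vertex set $G\setminus Cyc(G)$ in which $x$ and $y$ are adjacent if and only if $\langle x,y\rangle$ is not cyclic, and let $\overline{\Gamma}_G$ be its complement. For a finite graph $\Gamma$, let $\gamma(\Gamma)$ be its domination number, that is, the smallest size of a set $D$ of vertices such that every vertex not in $D$ is adjacent to at least one vertex of $D$. Write $D_{2m}$ for the dihedral group of order $2m$. Then: (i) $\gamma(\Gamma_G)+\gamma(\overline{\Gamma}_G)=n$ if and only if $G$ is an elementary abelian $2$-group; (ii) $\gamma(\Gamma_G)+\gamma(\overline{\Gamma}_G)=n-1$ if and only if $G\cong S_3$; (iii) $\gamma(\Gamma_G)+\gamma(\overline{\Gamma}_G)=n-2$ if and only if $G\cong D_8$; (iv) $\gamma(\Gamma_G)+\gamma(\overline{\Gamma}_G)=n-3$ if and only if $G\cong D_{10}$ or $G\cong \mathbb{Z}_3\oplus\mathbb{Z}_3$.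 -/

import Mathlib

/-- A group is locally cyclic if each of its finitely generated subgroups is cyclic. -/
def LocallyCyclic (G : Type*) [Group G] : Prop :=
  ∀ H : Subgroup G, H.FG → IsCyclic H

/-- The cyclicizer of `G`: the elements `y` such that `⟨x, y⟩` is cyclic for all `x`. -/
def cyclicizer (G : Type*) [Group G] : Set G :=
  {y | ∀ x : G, IsCyclic (Subgroup.closure ({x, y} : Set G))}

/-- The non-cyclic graph of `G`: its vertices are the elements outside the cyclicizer, and
`x`, `y` are adjacent when `⟨x, y⟩` is not cyclic. -/
def nonCyclicGraph (G : Type*) [Group G] : SimpleGraph {x : G // x ∉ cyclicizer G} where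
  Adj x y := ¬ IsCyclic (Subgroup.closure ({x.1, y.1} : Set G))
  symm := ⟨fun x y h => by rwa [Set.pair_comm]⟩
  loopless := ⟨fun x h => h (by
    rw [Set.pair_eq_singleton, ← Subgroup.zpowers_eq_closure]; infer_instance)⟩

/-- A set of vertices is dominating if every vertex outside it is adjacent to one inside it. -/
def IsDominatingSet {V : Type*} (Γ : SimpleGraph V) (D : Set V) : Prop :=
  ∀ v, v ∉ D → ∃ u ∈ D, Γ.Adj v u

/-- The domination number of a finite graph: the smallest size of a dominating set. -/
noncomputable def dominationNumber {V : Type*} (Γ : SimpleGraph V) : ℕ :=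
  sInf {k : ℕ | ∃ D : Finset V, IsDominatingSet Γ (D : Set V) ∧ D.card = k}

/-- An elementary abelian `2`-group: an abelian group all of whose elements `x` satisfy
`x ^ 2 = 1`. -/
def IsElementaryAbelianTwoGroup (G : Type*) [Group G] : Prop :=
  (∀ x y : G, x * y = y * x) ∧ ∀ x : G, x ^ 2 = 1

/-!
Write `γ` and `γ'` for the domination numbers of the non-cyclic graph and of its complement, and `n`
for the order of `G`. The vertices are the nontrivial elements, and two of them are joined in the
complement when they share a cyclic subgroup.

*Bounds.* A set `S` of nontrivial elements each of which shares a cyclic subgroup with some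
nontrivial element outside `S` (`IsRedundant`) can be omitted from a dominating set of the
complement, so `|S| + γ' ≤ n - 1` (`IsRedundant.card_add_dominationNumber_le`). If `x` generates a
maximal cyclic subgroup, then `γ ≤ 1 + ω`, where `ω` is the number of primes dividing the order of
`x`, and `γ = 1` if that order is `2` (`IsMaximalCyclic.dominationNumber_le`,
`IsMaximalCyclic.dominationNumber_eq_one`). Hence `γ + γ' ≥ n - 3` forces `|S| ≤ γ + 2` for every
redundant set `S`.

*Some maximal cyclic subgroup has order two.* Then `|S| ≤ 3`, all elements have order at most `5`,
and exhibiting redundant sets with four elements shows that all elements outside some cyclic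
subgroup of order `c`, with `2 ≤ c ≤ 5`, are involutions (`exists_isDihedralLike`). Such a group
is elementary abelian for `c = 2` and dihedral of order `2 * c` for `c ≥ 3`, and satisfies
`γ + γ' = n + 2 - c` (`IsDihedralLike.dominationNumber_add`).

*No maximal cyclic subgroup has order two.* Then there are at least twice as many elements of
composite order as involutions, while the elements of composite order and half of those of odd prime
order form a redundant set. This bounds `n` linearly by the size of redundant sets
(`two_mul_card_add_ncard_le`); applied first with `γ ≤ 3` and then with `γ ≤ 2`, it leaves only the
group of order `9` and exponent `3` (`card_eq_nine`), for which `γ + γ' = 6 = n - 3`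
(`dominationNumber_add_of_card_eq_nine`).
-/

/-! ### Elements that share a cyclic subgroup -/

/-- Two elements share a cyclic subgroup when both are powers of a single element; equivalently,
the subgroup they generate is cyclic. -/
def ShareCyclic {G : Type*} [Group G] (x y : G) : Prop :=
  ∃ g : G, x ∈ Subgroup.zpowers g ∧ y ∈ Subgroup.zpowers g

section Basic

variable {G : Type*} [Group G]

lemma isCyclic_closure_pair_iff (x y : G) :
    IsCyclic (Subgroup.closure ({x, y} : Set G)) ↔ ShareCyclic x y := by
  constructor
  · intro h
    obtain ⟨g, hg⟩ := (Subgroup.isCyclic_iff_exists_zpowers_eq_top _).1 h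
    refine ⟨g, ?_, ?_⟩ <;> rw [hg] <;> exact Subgroup.subset_closure (by simp)
  · rintro ⟨g, hx, hy⟩
    have hle : Subgroup.closure ({x, y} : Set G) ≤ Subgroup.zpowers g := by
      rw [Subgroup.closure_le]
      rintro z (rfl | rfl) <;> assumption
    exact Subgroup.isCyclic_of_le hle

lemma ShareCyclic.symm {x y : G} (h : ShareCyclic x y) : ShareCyclic y x :=
  let ⟨g, hx, hy⟩ := h
  ⟨g, hy, hx⟩

lemma ShareCyclic.of_mem {x y : G} (h : y ∈ Subgroup.zpowers x) : ShareCyclic x y :=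
  ⟨x, Subgroup.mem_zpowers x, h⟩

lemma shareCyclic_one_right (x : G) : ShareCyclic x 1 := .of_mem (one_mem _)

lemma shareCyclic_inv_right (x : G) : ShareCyclic x x⁻¹ :=
  .of_mem (inv_mem (Subgroup.mem_zpowers x))

lemma ShareCyclic.mono_left {x y z : G} (h : ShareCyclic x y) (hz : z ∈ Subgroup.zpowers x) :
    ShareCyclic z y :=
  let ⟨g, hx, hy⟩ := h
  ⟨g, (Subgroup.zpowers_le.2 hx) hz, hy⟩

/-- A cyclic group has at most one involution. -/
lemma ShareCyclic.eq_of_sq_eq_one [Finite G] {x y : G} (h : ShareCyclic x y) (hx : x ≠ 1)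
    (hy : y ≠ 1) (hx2 : x ^ 2 = 1) (hy2 : y ^ 2 = 1) : x = y := by
  obtain ⟨g, hxg, hyg⟩ := h
  classical
  have key : ∀ z ∈ Subgroup.zpowers g, z ≠ 1 → z ^ 2 = 1 → z = g ^ (orderOf g / 2) := by
    intro z hz hz1 hz2
    obtain ⟨k, hk, rfl⟩ := (mem_zpowers_iff_mem_range_orderOf (x := g)).1 hz |> Finset.mem_image.1
    have hk := Finset.mem_range.1 hk
    rw [← pow_mul] at hz2
    obtain ⟨c, hc⟩ := orderOf_dvd_of_pow_eq_one hz2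
    have : c = 1 := by
      have h0 : k ≠ 0 := by rintro rfl; simp at hz1
      have : c < 2 := by
        by_contra! hc2
        nlinarith
      have : c ≠ 0 := by rintro rfl; omega
      omega
    subst this
    congr 1
    omega
  rw [key x hxg hx hx2, key y hyg hy hy2]

/-- In the cyclic group `⟨x⟩`, an element whose order is divisible by `p` has a power that
generates the unique subgroup of order `p`. -/
lemma pow_orderOf_div_mem_zpowers [Finite G] {x v : G} (hv : v ∈ Subgroup.zpowers x) {p : ℕ}
    (hp : p ∣ orderOf v) : x ^ (orderOf x / p) ∈ Subgroup.zpowers v := by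
  obtain ⟨k, rfl⟩ := mem_powers_iff_mem_zpowers.2 hv
  simp only at hp ⊢
  have hgcd : x ^ (orderOf x).gcd k ∈ Subgroup.zpowers (x ^ k) := by
    refine ⟨(orderOf x).gcdB k, ?_⟩
    rw [← zpow_natCast x ((orderOf x).gcd k), Nat.gcd_eq_gcd_ab, zpow_add, zpow_mul, zpow_mul]
    simp
  rw [orderOf_pow] at hp
  have hdvd : (orderOf x).gcd k ∣ orderOf x / p := by
    obtain ⟨m, hm⟩ := hp
    obtain ⟨e, he⟩ := Nat.gcd_dvd_left (orderOf x) k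
    have hg : 0 < (orderOf x).gcd k := Nat.gcd_pos_of_pos_left _ (orderOf_pos x)
    have hem : e = p * m := by rw [← hm]; exact (Nat.div_eq_of_eq_mul_right hg he).symm
    rcases Nat.eq_zero_or_pos p with rfl | hp0
    · simp
    · exact ⟨m, Nat.div_eq_of_eq_mul_right hp0 (he.trans (by rw [hem]; ring))⟩
  obtain ⟨m, hm⟩ := hdvd
  rw [hm, pow_mul]
  exact pow_mem hgcd m

/-- An element is maximal cyclic when it generates a maximal cyclic subgroup. -/
def IsMaximalCyclic (x : G) : Prop := ∀ y : G, ShareCyclic x y → y ∈ Subgroup.zpowers x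

lemma exists_isMaximalCyclic [Finite G] (g : G) :
    ∃ x : G, IsMaximalCyclic x ∧ g ∈ Subgroup.zpowers x := by
  obtain ⟨x, hx, hmax⟩ := Set.exists_max_image {x : G | g ∈ Subgroup.zpowers x} orderOf
    (Set.toFinite _) ⟨g, Subgroup.mem_zpowers g⟩
  refine ⟨x, ?_, hx⟩
  rintro y ⟨w, hxw, hyw⟩
  have hle : Subgroup.zpowers x ≤ Subgroup.zpowers w := Subgroup.zpowers_le.2 hxw
  have hcard := hmax w (hle hx)
  rw [← Nat.card_zpowers, ← Nat.card_zpowers] at hcard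
  rwa [Subgroup.eq_of_le_of_card_ge hle hcard]

/-! ### Domination in the non-cyclic graph and its complement -/

lemma dominationNumber_le (Γ : SimpleGraph {x : G // x ∉ cyclicizer G}) (D : Finset G)
    (h : ∀ v : {x : G // x ∉ cyclicizer G}, v.1 ∉ D → ∃ u, u.1 ∈ D ∧ Γ.Adj v u) :
    dominationNumber Γ ≤ D.card := by
  classical
  have hD : IsDominatingSet Γ (D.subtype (· ∉ cyclicizer G) : Set _) := fun v hv => by
    obtain ⟨u, hu, ha⟩ := h v (by simpa using hv)
    exact ⟨u, by simpa using hu, ha⟩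
  have hle : dominationNumber Γ ≤ (D.subtype (· ∉ cyclicizer G)).card :=
    Nat.sInf_le ⟨_, hD, rfl⟩
  refine hle.trans ?_
  rw [Finset.card_subtype]
  exact Finset.card_filter_le _ _

lemma exists_card_eq_dominationNumber [Finite G] (Γ : SimpleGraph {x : G // x ∉ cyclicizer G}) :
    ∃ D : Finset {x : G // x ∉ cyclicizer G},
      IsDominatingSet Γ (D : Set _) ∧ D.card = dominationNumber Γ := by
  classical
  have := Fintype.ofFinite {x : G // x ∉ cyclicizer G}
  exact Nat.sInf_mem (s := {k : ℕ | ∃ D : Finset {x : G // x ∉ cyclicizer G},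
    IsDominatingSet Γ (D : Set _) ∧ D.card = k})
    ⟨_, Finset.univ, fun v hv => (hv (by simp)).elim, rfl⟩

lemma nonCyclicGraph_adj {x y : {x : G // x ∉ cyclicizer G}} :
    (nonCyclicGraph G).Adj x y ↔ ¬ ShareCyclic x.1 y.1 := by
  rw [← isCyclic_closure_pair_iff]; rfl

lemma compl_nonCyclicGraph_adj {x y : {x : G // x ∉ cyclicizer G}} :
    (nonCyclicGraph G)ᶜ.Adj x y ↔ x ≠ y ∧ ShareCyclic x.1 y.1 := by
  rw [SimpleGraph.compl_adj, nonCyclicGraph_adj, not_not]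

lemma one_mem_cyclicizer : (1 : G) ∈ cyclicizer G := fun x =>
  (isCyclic_closure_pair_iff x 1).2 (shareCyclic_one_right x)

lemma notMem_cyclicizer_iff (hC : cyclicizer G = {1}) {x : G} : x ∉ cyclicizer G ↔ x ≠ 1 := by
  simp [hC]

lemma exists_not_shareCyclic (hC : cyclicizer G = {1}) {x : G} (hx : x ≠ 1) :
    ∃ y : G, ¬ ShareCyclic x y := by
  have h := (notMem_cyclicizer_iff hC).2 hx
  simp only [cyclicizer, Set.mem_ofPred_eq, not_forall, isCyclic_closure_pair_iff] at h
  obtain ⟨y, hy⟩ := h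
  exact ⟨y, fun h' => hy h'.symm⟩

lemma dominationNumber_nonCyclicGraph_le (hC : cyclicizer G = {1}) (D : Finset G)
    (h : ∀ v : G, v ≠ 1 → v ∉ D → ∃ u ∈ D, ¬ ShareCyclic v u) :
    dominationNumber (nonCyclicGraph G) ≤ D.card := by
  refine dominationNumber_le _ D fun v hv => ?_
  obtain ⟨u, hu, ha⟩ := h v ((notMem_cyclicizer_iff hC).1 v.2) hv
  have hu1 : u ≠ 1 := by rintro rfl; exact ha (shareCyclic_one_right _)
  exact ⟨⟨u, (notMem_cyclicizer_iff hC).2 hu1⟩, hu, nonCyclicGraph_adj.2 ha⟩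

lemma one_le_dominationNumber [Finite G] (hC : cyclicizer G = {1}) [Nontrivial G]
    (Γ : SimpleGraph {x : G // x ∉ cyclicizer G}) : 1 ≤ dominationNumber Γ := by
  obtain ⟨D, hD, hc⟩ := exists_card_eq_dominationNumber Γ
  rw [← hc, Nat.one_le_iff_ne_zero, Finset.card_ne_zero]
  obtain ⟨x, hx⟩ := exists_ne (1 : G)
  let v : {x : G // x ∉ cyclicizer G} := ⟨x, (notMem_cyclicizer_iff hC).2 hx⟩
  by_cases hv : v ∈ D
  · exact ⟨v, hv⟩
  · obtain ⟨u, hu, -⟩ := hD v (by simpa using hv)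
    exact ⟨u, by simpa using hu⟩

/-- A finite set of nontrivial elements each of which shares a cyclic subgroup with some
nontrivial element outside the set. Its complement in the vertex set therefore dominates the
complement of the non-cyclic graph. -/
def IsRedundant (S : Finset G) : Prop :=
  1 ∉ S ∧ ∀ x ∈ S, ∃ y, y ∉ S ∧ y ≠ 1 ∧ ShareCyclic x y

lemma IsRedundant.card_add_dominationNumber_le [Finite G] (hC : cyclicizer G = {1})
    {S : Finset G} (hS : IsRedundant S) :
    S.card + dominationNumber (nonCyclicGraph G)ᶜ + 1 ≤ Nat.card G := by
  classical
  have := Fintype.ofFinite G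
  have hle : dominationNumber (nonCyclicGraph G)ᶜ ≤ (insert 1 S)ᶜ.card := by
    refine dominationNumber_le _ _ fun v hv => ?_
    have hv1 := (notMem_cyclicizer_iff hC).1 v.2
    have hvS : v.1 ∈ S := by simpa [hv1] using hv
    obtain ⟨y, hyS, hy1, hy⟩ := hS.2 _ hvS
    refine ⟨⟨y, (notMem_cyclicizer_iff hC).2 hy1⟩, by simp [hyS, hy1],
      compl_nonCyclicGraph_adj.2 ⟨?_, hy⟩⟩
    rintro rfl
    exact hyS hvS
  have h1 := Finset.card_add_card_compl (insert 1 S)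
  rw [Finset.card_insert_of_notMem hS.1, ← Nat.card_eq_fintype_card] at h1
  omega

/-- A generator `x` of a maximal cyclic subgroup dominates everything outside that subgroup, and
for each prime `p` dividing its order one further vertex dominates the elements of the subgroup
whose order is divisible by `p`. -/
lemma IsMaximalCyclic.dominationNumber_le [Finite G] (hC : cyclicizer G = {1}) {x : G}
    (hx : IsMaximalCyclic x) :
    dominationNumber (nonCyclicGraph G) ≤ (orderOf x).primeFactors.card + 1 := by
  classical
  have hex : ∀ p : ℕ, p ∈ (orderOf x).primeFactors →
      ∃ y, ¬ ShareCyclic (x ^ (orderOf x / p)) y := by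
    intro p hp
    refine exists_not_shareCyclic hC fun h => ?_
    have hpp := Nat.prime_of_mem_primeFactors hp
    have hpd := Nat.dvd_of_mem_primeFactors hp
    have h2 := Nat.le_of_dvd (Nat.div_pos (Nat.le_of_dvd (orderOf_pos x) hpd) hpp.pos)
      (orderOf_dvd_of_pow_eq_one h)
    exact absurd (Nat.div_lt_self (orderOf_pos x) hpp.one_lt) (by omega)
  choose! y hy using hex
  refine (dominationNumber_nonCyclicGraph_le hC
    (insert x ((orderOf x).primeFactors.image y)) fun v hv1 hv => ?_).trans
    ((Finset.card_insert_le _ _).trans (Nat.succ_le_succ Finset.card_image_le))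
  by_cases hvx : v ∈ Subgroup.zpowers x
  · obtain ⟨p, hp, hpv⟩ := Nat.exists_prime_and_dvd (n := orderOf v) (by simpa using hv1)
    have hpx : p ∈ (orderOf x).primeFactors :=
      Nat.mem_primeFactors.2 ⟨hp, hpv.trans (orderOf_dvd_of_mem_zpowers hvx), (orderOf_pos x).ne'⟩
    refine ⟨y p, Finset.mem_insert_of_mem (Finset.mem_image_of_mem y hpx), fun hs =>
      hy p hpx (hs.mono_left ?_)⟩
    exact pow_orderOf_div_mem_zpowers hvx hpv
  · exact ⟨x, by simp, fun hs => hvx (hx v hs.symm)⟩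

/-- A maximal cyclic involution is adjacent to every other vertex of the non-cyclic graph. -/
lemma IsMaximalCyclic.dominationNumber_eq_one [Finite G] (hC : cyclicizer G = {1}) {x : G}
    (hx : IsMaximalCyclic x) (h2 : orderOf x = 2) : dominationNumber (nonCyclicGraph G) = 1 := by
  have : Nontrivial G := ⟨x, 1, fun h => by simp [h] at h2⟩
  refine le_antisymm ((dominationNumber_nonCyclicGraph_le hC {x} fun v hv1 hv => ?_).trans
    (by simp)) (one_le_dominationNumber hC _)
  refine ⟨x, by simp, fun hs => ?_⟩
  have hvx := hx v hs.symm
  have hx2 : x ^ 2 = 1 := h2 ▸ pow_orderOf_eq_one x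
  have hv2 : v ^ 2 = 1 := orderOf_dvd_iff_pow_eq_one.1 (h2 ▸ orderOf_dvd_of_mem_zpowers hvx)
  exact hv (by simpa using hs.eq_of_sq_eq_one hv1 (fun h => by simp [h] at h2) hv2 hx2)

end Basic

/-! ### Groups in which all elements outside a cyclic subgroup are involutions -/

/-- There is an element `a` of order `c` such that `⟨a⟩` is a proper subgroup and every element
outside `⟨a⟩` squares to `1`. For `c = 2` these are the elementary abelian `2`-groups of order at
least `4`, for `c ≥ 3` the dihedral groups of order `2 * c`. -/
def IsDihedralLike (G : Type*) [Group G] (c : ℕ) : Prop :=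
  ∃ a : G, orderOf a = c ∧ (∃ x, x ∉ Subgroup.zpowers a) ∧
    ∀ x, x ∉ Subgroup.zpowers a → x ^ 2 = 1

section DihedralLike

variable {G : Type*} [Group G]

/-- Elements outside `⟨a⟩` act on `⟨a⟩` by inversion. -/
lemma mul_mul_eq_inv_of_forall_sq {a x v : G} (h : ∀ x, x ∉ Subgroup.zpowers a → x ^ 2 = 1)
    (hx : x ∉ Subgroup.zpowers a) (hv : v ∈ Subgroup.zpowers a) : x * v * x = v⁻¹ := by
  have hxv : x * v ∉ Subgroup.zpowers a := fun h' => hx ((Subgroup.mul_mem_cancel_right _ hv).1 h')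
  have := h _ hxv
  rw [eq_inv_iff_mul_eq_one, ← this, pow_two, mul_assoc]

/-- An element outside `⟨a⟩` shares a cyclic subgroup only with itself and `1`. -/
lemma ShareCyclic.eq_of_forall_sq [Finite G] {a x v : G}
    (h : ∀ x, x ∉ Subgroup.zpowers a → x ^ 2 = 1) (hx : x ∉ Subgroup.zpowers a) (hv : v ≠ 1)
    (hs : ShareCyclic v x) : v = x := by
  have hx1 : x ≠ 1 := by rintro rfl; exact hx (one_mem _)
  refine hs.eq_of_sq_eq_one hv hx1 ?_ (h x hx)
  by_cases hva : v ∈ Subgroup.zpowers a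
  · have h1 := mul_mul_eq_inv_of_forall_sq h hx hva
    obtain ⟨g, ⟨i, rfl⟩, ⟨j, rfl⟩⟩ := hs
    have hx2 := h _ hx
    simp only at h1 hx2 ⊢
    have hc : g ^ j * g ^ i * g ^ j = g ^ i * (g ^ j) ^ 2 := by group
    rw [hc, hx2, mul_one, eq_inv_iff_mul_eq_one] at h1
    rw [pow_two, h1]
  · exact h v hva

lemma ncard_zpowers_compl [Finite G] (a : G) :
    ((Subgroup.zpowers a : Set G)ᶜ).ncard + orderOf a = Nat.card G := by
  rw [← Nat.card_zpowers, add_comm]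
  exact Set.ncard_add_ncard_compl _

lemma isRedundant_powers [Finite G] {a : G} (ha : a ≠ 1) : ∃ S : Finset G,
    IsRedundant S ∧ S.card + 2 = orderOf a ∧
      ∀ x, x ∈ S ↔ x ∈ Subgroup.zpowers a ∧ x ≠ 1 ∧ x ≠ a := by
  classical
  have := Fintype.ofFinite G
  have hmem : ∀ x, x ∈ (((Subgroup.zpowers a : Set G).toFinset.erase 1).erase a) ↔
      x ∈ Subgroup.zpowers a ∧ x ≠ 1 ∧ x ≠ a := by
    intro x; simp; tauto
  refine ⟨((Subgroup.zpowers a : Set G).toFinset.erase 1).erase a, ⟨by simp, fun x hx => ?_⟩, ?_,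
    hmem⟩
  · exact ⟨a, by simp, ha, (ShareCyclic.of_mem ((hmem x).1 hx).1).symm⟩
  · have h1 : (Subgroup.zpowers a : Set G).toFinset.card = orderOf a := by
      rw [← Nat.card_zpowers, Set.toFinset_card, Nat.card_eq_fintype_card]; rfl
    have h2 : 2 ≤ orderOf a := by
      have := orderOf_pos a
      have : orderOf a ≠ 1 := by simpa using ha
      omega
    rw [Finset.card_erase_of_mem (by simp [ha]), Finset.card_erase_of_mem (by simp), h1]
    omega

lemma IsDihedralLike.dominationNumber_add [Finite G] (hC : cyclicizer G = {1}) {c : ℕ} (hc : 2 ≤ c)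
    (h : IsDihedralLike G c) : dominationNumber (nonCyclicGraph G) +
      dominationNumber (nonCyclicGraph G)ᶜ + c = Nat.card G + 2 := by
  classical
  obtain ⟨a, rfl, ⟨x, hx⟩, hsq⟩ := h
  have ha : a ≠ 1 := by rintro rfl; simp at hc
  have : Nontrivial G := ⟨a, 1, ha⟩
  have h1 : dominationNumber (nonCyclicGraph G) = 1 := by
    refine le_antisymm ((dominationNumber_nonCyclicGraph_le hC {x} fun v hv1 hv => ?_).trans
      (by simp)) (one_le_dominationNumber hC _)
    exact ⟨x, by simp, fun hs => hv (by simpa using hs.eq_of_forall_sq hsq hx hv1)⟩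
  obtain ⟨S, hS, hScard, -⟩ := isRedundant_powers ha
  have hle := hS.card_add_dominationNumber_le hC
  have hge : Nat.card G + 1 ≤ dominationNumber (nonCyclicGraph G)ᶜ + orderOf a := by
    obtain ⟨D, hD, hcard⟩ := exists_card_eq_dominationNumber (nonCyclicGraph G)ᶜ
    -- The vertices outside `⟨a⟩` are isolated, and `a` needs a dominating vertex inside `⟨a⟩`.
    have hiso : ∀ v, v.1 ∉ Subgroup.zpowers a → v ∈ D := by
      intro v hv
      by_contra hvD
      obtain ⟨u, -, hu⟩ := hD v (by simpa using hvD)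
      obtain ⟨hne, hs⟩ := compl_nonCyclicGraph_adj.1 hu
      exact hne (Subtype.ext
        (hs.symm.eq_of_forall_sq hsq hv ((notMem_cyclicizer_iff hC).1 u.2)).symm)
    obtain ⟨u, huD, hu⟩ : ∃ u ∈ D, u.1 ∈ Subgroup.zpowers a := by
      let w : {x : G // x ∉ cyclicizer G} := ⟨a, (notMem_cyclicizer_iff hC).2 ha⟩
      by_cases hw : w ∈ D
      · exact ⟨w, hw, Subgroup.mem_zpowers a⟩
      · obtain ⟨u, huD, hu⟩ := hD w (by simpa using hw)
        refine ⟨u, by simpa using huD, ?_⟩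
        by_contra hua
        obtain ⟨hne, hs⟩ := compl_nonCyclicGraph_adj.1 hu
        exact hne (Subtype.ext (hs.eq_of_forall_sq hsq hua ha))
    have hsub : insert u.1 ((Subgroup.zpowers a : Set G)ᶜ) ⊆
        ((D.image Subtype.val : Finset G) : Set G) := by
      rintro y (rfl | hy)
      · simpa using ⟨u.2, huD⟩
      · have hy1 : y ∉ cyclicizer G :=
          (notMem_cyclicizer_iff hC).2 (by rintro rfl; exact hy (one_mem _))
        simpa using ⟨hy1, hiso ⟨y, hy1⟩ hy⟩
    have h2 := Set.ncard_le_ncard hsub (Set.toFinite _)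
    rw [Set.ncard_coe_finset, Set.ncard_insert_of_notMem (by simpa using hu)] at h2
    have h3 : (D.image Subtype.val).card ≤ D.card := Finset.card_image_le
    have h4 := ncard_zpowers_compl a
    omega
  omega

lemma isDihedralLike_two_iff [Finite G] (hG : ¬ IsCyclic G) :
    IsDihedralLike G 2 ↔ IsElementaryAbelianTwoGroup G := by
  constructor
  · rintro ⟨a, ha, -, hsq⟩
    have hall : ∀ x : G, x ^ 2 = 1 := fun x => by
      by_cases hx : x ∈ Subgroup.zpowers a
      · exact orderOf_dvd_iff_pow_eq_one.1 (ha ▸ orderOf_dvd_of_mem_zpowers hx)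
      · exact hsq x hx
    refine ⟨fun x y => ?_, hall⟩
    have hinv : ∀ z : G, z⁻¹ = z := fun z => by
      rw [inv_eq_iff_mul_eq_one, ← pow_two, hall]
    rw [← hinv (x * y), mul_inv_rev, hinv, hinv]
  · rintro ⟨-, hall⟩
    have : Nontrivial G := by
      by_contra h
      rw [not_nontrivial_iff_subsingleton] at h
      exact hG isCyclic_of_subsingleton
    obtain ⟨a, ha⟩ := exists_ne (1 : G)
    refine ⟨a, orderOf_eq_prime (hall a) ha, ?_, fun x _ => hall x⟩
    by_contra! h
    exact hG ⟨a, h⟩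

lemma IsDihedralLike.of_mulEquiv {H : Type*} [Group H] {c : ℕ} (e : G ≃* H)
    (h : IsDihedralLike H c) : IsDihedralLike G c := by
  obtain ⟨a, rfl, ⟨x, hx⟩, hsq⟩ := h
  have hmem : ∀ y, y ∈ Subgroup.zpowers (e.symm a) ↔ e y ∈ Subgroup.zpowers a := by
    intro y
    simp only [Subgroup.mem_zpowers_iff, ← map_zpow, MulEquiv.symm_apply_eq]
  refine ⟨e.symm a, by simp, ⟨e.symm x, by simpa [hmem] using hx⟩, fun y hy => ?_⟩
  apply e.injective
  rw [map_pow, map_one, hsq _ (by rwa [hmem] at hy)]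

lemma isDihedralLike_dihedralGroup {c : ℕ} [NeZero c] : IsDihedralLike (DihedralGroup c) c := by
  have hmem : ∀ i : ZMod c, DihedralGroup.r i ∈ Subgroup.zpowers (DihedralGroup.r 1) := fun i =>
    ⟨i.val, by simp⟩
  refine ⟨.r 1, DihedralGroup.orderOf_r_one, ⟨.sr 0, ?_⟩, ?_⟩
  · rintro ⟨k, hk⟩
    simp at hk
  · rintro (i | i) hi
    · exact (hi (hmem i)).elim
    · rw [pow_two, DihedralGroup.sr_mul_self]

/-- Two groups with this structure and the same `c ≥ 3` are isomorphic: both are generated by `a`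
and an involution inverting `a`, and the elements outside `⟨a⟩` form a single coset. -/
lemma IsDihedralLike.nonempty_mulEquiv [Finite G] {c : ℕ} (hc : 3 ≤ c) (h : IsDihedralLike G c) :
    Nonempty (G ≃* DihedralGroup c) := by
  obtain ⟨a, rfl, ⟨x, hx⟩, hsq⟩ := h
  have hinv : ∀ y, y ∉ Subgroup.zpowers a → ∀ v ∈ Subgroup.zpowers a, y * v = v⁻¹ * y := by
    intro y hy v hv
    rw [← mul_mul_eq_inv_of_forall_sq hsq hy hv, mul_assoc _ y y, ← pow_two, hsq y hy, mul_one]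
  -- If `x * y` were outside `⟨a⟩`, it would both centralize and invert `a`.
  have hcoset : ∀ y, y ∉ Subgroup.zpowers a → x * y ∈ Subgroup.zpowers a := by
    intro y hy
    by_contra hxy
    have ha := Subgroup.mem_zpowers a
    have h1 := hinv _ hxy a ha
    rw [mul_assoc, hinv y hy a ha, ← mul_assoc, hinv x hx _ (inv_mem ha), inv_inv, mul_assoc,
      mul_left_inj, eq_inv_iff_mul_eq_one, ← pow_two] at h1
    have := Nat.le_of_dvd two_pos (orderOf_dvd_of_pow_eq_one h1)
    omega
  have : NeZero (orderOf a) := ⟨by omega⟩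
  have hxx : x * x = 1 := by rw [← pow_two, hsq x hx]
  let p : ZMod (orderOf a) → G := fun i => a ^ i.val
  have hp : ∀ i, p i ∈ Subgroup.zpowers a := fun i => Subgroup.npow_mem_zpowers a _
  have hpadd : ∀ i j, p (i + j) = p i * p j := by
    intro i j
    simp only [p]
    rw [ZMod.val_add, pow_mod_orderOf, pow_add]
  have hp0 : p 0 = 1 := by simp [p]
  have hpneg : ∀ i, p (-i) = (p i)⁻¹ := by
    intro i
    rw [eq_inv_iff_mul_eq_one, ← hpadd, neg_add_cancel, hp0]
  have hpcomm : ∀ i j, p i * p j = p j * p i := fun i j => by rw [← hpadd, add_comm, hpadd]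
  let f : DihedralGroup (orderOf a) → G
    | .r i => p i
    | .sr i => x * p i
  have hf : ∀ u v, f (u * v) = f u * f v := by
    rintro (i | i) (j | j)
    · simp only [DihedralGroup.r_mul_r, f, hpadd]
    · simp only [DihedralGroup.r_mul_sr, f, sub_eq_add_neg, hpadd, hpneg]
      rw [← mul_assoc (p i) x, ← inv_inv (p i), ← hinv x hx _ (inv_mem (hp i)), inv_inv, mul_assoc,
        ← hpneg, hpcomm]
    · simp only [DihedralGroup.sr_mul_r, f, hpadd, mul_assoc]
    · simp only [DihedralGroup.sr_mul_sr, f, sub_eq_add_neg, hpadd, hpneg]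
      rw [← mul_assoc (x * p i) x, hinv x hx _ (hp i), mul_assoc _ x x, hxx, mul_one, ← hpneg,
        hpcomm]
  refine ⟨(MulEquiv.ofBijective (MonoidHom.mk' f hf) ⟨?_, ?_⟩).symm⟩
  · rw [injective_iff_map_eq_one]
    rintro (i | i) hi
    · have : orderOf a ∣ i.val := orderOf_dvd_of_pow_eq_one hi
      have h0 : i = 0 := (ZMod.val_eq_zero i).1 (Nat.eq_zero_of_dvd_of_lt this (ZMod.val_lt i))
      rw [h0, DihedralGroup.r_zero]
    · have hi : x * p i = 1 := hi
      exact (hx (by rw [eq_inv_of_mul_eq_one_left hi]; exact inv_mem (hp i))).elim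
  · have hsurj : ∀ y ∈ Subgroup.zpowers a, ∃ i, p i = y := by
      intro y hy
      obtain ⟨k, rfl⟩ := mem_powers_iff_mem_zpowers.2 hy
      exact ⟨k, by simp [p, ZMod.val_natCast, pow_mod_orderOf]⟩
    intro y
    by_cases hy : y ∈ Subgroup.zpowers a
    · obtain ⟨i, hi⟩ := hsurj y hy
      exact ⟨.r i, hi⟩
    · obtain ⟨i, hi⟩ := hsurj _ (hcoset y hy)
      refine ⟨.sr i, ?_⟩
      change x * p i = y
      rw [hi, ← mul_assoc, hxx, one_mul]

lemma isDihedralLike_iff_nonempty_mulEquiv [Finite G] {c : ℕ} (hc : 3 ≤ c) :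
    IsDihedralLike G c ↔ Nonempty (G ≃* DihedralGroup c) := by
  have : NeZero c := ⟨by omega⟩
  exact ⟨fun h => h.nonempty_mulEquiv hc, fun ⟨e⟩ => isDihedralLike_dihedralGroup.of_mulEquiv e⟩

lemma isDihedralLike_perm_fin_three : IsDihedralLike (Equiv.Perm (Fin 3)) 3 := by
  refine ⟨finRotate 3, orderOf_eq_prime (by decide) (by decide), ⟨Equiv.swap 0 1, ?_⟩, ?_⟩
  · intro h
    have := orderOf_dvd_of_mem_zpowers h
    rw [orderOf_eq_prime (p := 2) (by decide) (by decide),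
      orderOf_eq_prime (p := 3) (by decide) (by decide)] at this
    omega
  · have key : ∀ x : Equiv.Perm (Fin 3), x ^ 2 = 1 ∨ x = finRotate 3 ^ 0 ∨ x = finRotate 3 ^ 1 ∨
        x = finRotate 3 ^ 2 := by decide
    intro x hx
    rcases key x with h | h | h | h
    · exact h
    all_goals exact (hx (h ▸ Subgroup.npow_mem_zpowers _ _)).elim

lemma isDihedralLike_three_iff [Finite G] :
    IsDihedralLike G 3 ↔ Nonempty (G ≃* Equiv.Perm (Fin 3)) := by
  refine ⟨fun h => ?_, fun ⟨e⟩ => isDihedralLike_perm_fin_three.of_mulEquiv e⟩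
  obtain ⟨e⟩ := h.nonempty_mulEquiv le_rfl
  obtain ⟨e'⟩ := isDihedralLike_perm_fin_three.nonempty_mulEquiv le_rfl
  exact ⟨e.trans e'.symm⟩

end DihedralLike

/-! ### Groups in which every redundant set is small -/

section Redundant

variable {G : Type*} [Group G]

lemma isRedundant_of_inv_notMem {S : Finset G} (h1 : 1 ∉ S) (h : ∀ x ∈ S, x⁻¹ ∉ S) :
    IsRedundant S :=
  ⟨h1, fun x hx => ⟨x⁻¹, h x hx, by rw [ne_eq, inv_eq_one]; rintro rfl; exact h1 hx,
    shareCyclic_inv_right x⟩⟩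

lemma sq_ne_one_of_three_le_orderOf {x : G} (h : 3 ≤ orderOf x) : x ^ 2 ≠ 1 := fun h' => by
  have := Nat.le_of_dvd two_pos (orderOf_dvd_of_pow_eq_one h')
  omega

lemma ne_inv_iff_sq_ne_one {x : G} : x ≠ x⁻¹ ↔ x ^ 2 ≠ 1 := by
  rw [ne_eq, eq_inv_iff_mul_eq_one, pow_two]

lemma three_le_orderOf_of_sq_ne_one [Finite G] {x : G} (h : x ^ 2 ≠ 1) : 3 ≤ orderOf x := by
  have h0 := orderOf_pos x
  have h1 : orderOf x ≠ 1 := fun h1 => h (by simp [orderOf_eq_one_iff.1 h1])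
  have h2 : orderOf x ≠ 2 := fun h2 => h (h2 ▸ pow_orderOf_eq_one x)
  omega

lemma orderOf_le_of_forall_isRedundant [Finite G] {k : ℕ}
    (hS : ∀ S : Finset G, IsRedundant S → S.card ≤ k) (x : G) : orderOf x ≤ k + 2 := by
  by_cases hx : x = 1
  · simp [hx]
  · obtain ⟨S, hS1, hS2, -⟩ := isRedundant_powers hx
    have := hS S hS1
    omega

/-- If a proper cyclic subgroup `⟨a⟩` of order `k + 2` already yields a redundant set of the largest
possible size `k`, then no element outside it can be added to the set together with its inverse as
a dominator, so all these elements are involutions. -/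
lemma isDihedralLike_of_orderOf_eq [Finite G] (hG : ¬ IsCyclic G) {k : ℕ}
    (hS : ∀ S : Finset G, IsRedundant S → S.card ≤ k) {a : G} (ha : orderOf a = k + 2) :
    IsDihedralLike G (k + 2) := by
  classical
  refine ⟨a, ha, ?_, fun x hx => ?_⟩
  · by_contra! h
    exact hG ⟨a, h⟩
  · by_contra hx2
    have ha1 : a ≠ 1 := by rintro rfl; simp at ha
    obtain ⟨S, ⟨hS1, hS2⟩, hcard, hmem⟩ := isRedundant_powers ha1
    have hxS : x ∉ S := fun h => hx ((hmem x).1 h).1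
    have hx1 : x ≠ 1 := by rintro rfl; exact hx (one_mem _)
    have hred : IsRedundant (insert x S) := by
      refine ⟨by simp [hS1, hx1.symm], fun y hy => ?_⟩
      rcases Finset.mem_insert.1 hy with rfl | hy
      · refine ⟨y⁻¹, ?_, by simpa using hx1, shareCyclic_inv_right y⟩
        simp only [Finset.mem_insert, hmem, inv_mem_iff, hx, false_and, or_false]
        exact (ne_inv_iff_sq_ne_one.2 hx2).symm
      · refine ⟨a, ?_, ha1, (ShareCyclic.of_mem ((hmem y).1 hy).1).symm⟩
        simp only [Finset.mem_insert, hmem, not_or]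
        refine ⟨?_, by simp⟩
        rintro rfl
        exact hx (Subgroup.mem_zpowers _)
    have := hS _ hred
    rw [Finset.card_insert_of_notMem hxS] at this
    omega

/-- A group with an element of order `4` in which redundant sets have at most three elements:
the elements outside `⟨a⟩` are involutions, because another element of order `4`, or an element
`b` of order `3` together with a distinct conjugate, gives a redundant set of size four, whereas
if `a` normalizes `⟨b⟩` then `a ^ 2 * b` has order `6`. -/
lemma isDihedralLike_four [Finite G] (hG : ¬ IsCyclic G)
    (hS : ∀ S : Finset G, IsRedundant S → S.card ≤ 3)
    (h5 : ∀ x : G, orderOf x ≤ 4) {a : G} (ha : orderOf a = 4) : IsDihedralLike G 4 := by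
  classical
  have ha4 : a ^ 4 = 1 := ha ▸ pow_orderOf_eq_one a
  have ha2 : a ^ 2 ≠ 1 := sq_ne_one_of_three_le_orderOf (by omega)
  have ha22 : (a ^ 2) ^ 2 = 1 := by rw [← pow_mul, ha4]
  have hai : a⁻¹ ^ 2 ≠ 1 := by simpa using ha2
  have haa : a ≠ a⁻¹ := ne_inv_iff_sq_ne_one.2 ha2
  have hshare : ShareCyclic a (a ^ 2) := .of_mem (Subgroup.npow_mem_zpowers a 2)
  have hshare' : ShareCyclic a⁻¹ (a ^ 2) := hshare.mono_left (inv_mem (Subgroup.mem_zpowers a))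
  refine ⟨a, ha, ?_, fun b hb => ?_⟩
  · by_contra! h
    exact hG ⟨a, h⟩
  by_contra hb2
  have hba : b ≠ a := by rintro rfl; exact hb (Subgroup.mem_zpowers _)
  have hbai : b ≠ a⁻¹ := by rintro rfl; exact hb (inv_mem (Subgroup.mem_zpowers _))
  have hbi : b⁻¹ ^ 2 ≠ 1 := by simpa using hb2
  have hbb : b ≠ b⁻¹ := ne_inv_iff_sq_ne_one.2 hb2
  have ho : orderOf b = 3 ∨ orderOf b = 4 := by
    have := three_le_orderOf_of_sq_ne_one hb2
    have := h5 b
    omega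
  -- A set of elements with nontrivial square does not contain `1` or `a ^ 2`.
  have havoid : ∀ S : Finset G, (∀ y ∈ S, y ^ 2 ≠ 1) → ∀ z : G, z ^ 2 = 1 → z ∉ S :=
    fun S h z hz hzS => h z hzS hz
  rcases ho with ho | ho
  · have hb3 : b ^ 3 = 1 := ho ▸ pow_orderOf_eq_one b
    by_cases hn : a * b * a⁻¹ = b ∨ a * b * a⁻¹ = b⁻¹
    · have hcomm : Commute (a ^ 2) b := by
        have h2 : a * (a * b * a⁻¹) * a⁻¹ = b := by
          rcases hn with h | h
          · rw [h, h]
          · rw [h, ← conj_inv, h, inv_inv]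
        have : a ^ 2 * b = (a * (a * b * a⁻¹) * a⁻¹) * a ^ 2 := by
          simp [pow_two, mul_assoc]
        rwa [h2] at this
      have h6 := hcomm.orderOf_mul_eq_mul_orderOf_of_coprime (by
        rw [orderOf_eq_prime ha22 ha2, ho]; norm_num)
      rw [orderOf_eq_prime ha22 ha2, ho] at h6
      have := h5 (a ^ 2 * b)
      omega
    · push Not at hn
      set d := a * b * a⁻¹ with hd
      have hd2 : d ^ 2 ≠ 1 := by simpa [hd, conj_pow] using hb2
      have hd3 : d ^ 3 = 1 := by rw [hd, conj_pow, hb3]; simp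
      have hda : ∀ z : G, z ^ 3 = 1 → z ≠ a ∧ z ≠ a⁻¹ := by
        intro z hz
        constructor
        · rintro rfl
          have := Nat.le_of_dvd three_pos (orderOf_dvd_of_pow_eq_one hz)
          omega
        · rintro rfl
          have := Nat.le_of_dvd three_pos (orderOf_dvd_of_pow_eq_one hz)
          rw [orderOf_inv] at this
          omega
      have hdd : d ≠ d⁻¹ := ne_inv_iff_sq_ne_one.2 hd2
      have hb1 : b ≠ 1 := by rintro rfl; simp at hb2
      have hd1 : d ≠ 1 := by intro h; simp [h] at hd2
      have hsq : ∀ y ∈ ({a, a⁻¹, b, d} : Finset G), y ^ 2 ≠ 1 := by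
        simp only [Finset.mem_insert, Finset.mem_singleton]
        rintro y (rfl | rfl | rfl | rfl) <;> assumption
      have hbdi : b⁻¹ ≠ d := fun h => hn.2 h.symm
      have hdbi : d⁻¹ ≠ b := fun h => hn.2 (by rw [← h, inv_inv])
      have hred : IsRedundant ({a, a⁻¹, b, d} : Finset G) := by
        refine ⟨havoid _ hsq _ (one_pow 2), ?_⟩
        simp only [Finset.forall_mem_insert, Finset.mem_singleton, forall_eq]
        refine ⟨⟨a ^ 2, havoid _ hsq _ ha22, ha2, hshare⟩,
          ⟨a ^ 2, havoid _ hsq _ ha22, ha2, hshare'⟩,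
          ⟨b⁻¹, ?_, by simpa using hb1, shareCyclic_inv_right b⟩,
          ⟨d⁻¹, ?_, by simpa using hd1, shareCyclic_inv_right d⟩⟩
        · have := hda b⁻¹ (by rw [inv_pow, hb3, inv_one])
          simp [this, hbb.symm, hbdi]
        · have := hda d⁻¹ (by rw [inv_pow, hd3, inv_one])
          simp [this, hdd.symm, hdbi]
      have hcard : ({a, a⁻¹, b, d} : Finset G).card = 4 := by
        have := hda d hd3
        rw [Finset.card_insert_of_notMem, Finset.card_insert_of_notMem,
          Finset.card_insert_of_notMem, Finset.card_singleton]
        · simpa using hn.1.symm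
        · simpa using ⟨hbai.symm, this.2.symm⟩
        · simpa using ⟨haa, hba.symm, this.1.symm⟩
      have := hS _ hred
      omega
  · have hb4 : b ^ 4 = 1 := ho ▸ pow_orderOf_eq_one b
    have hb22 : (b ^ 2) ^ 2 = 1 := by rw [← pow_mul, hb4]
    have hshareb : ShareCyclic b (b ^ 2) := .of_mem (Subgroup.npow_mem_zpowers b 2)
    have hsq : ∀ y ∈ ({a, a⁻¹, b, b⁻¹} : Finset G), y ^ 2 ≠ 1 := by
      simp only [Finset.mem_insert, Finset.mem_singleton]
      rintro y (rfl | rfl | rfl | rfl) <;> assumption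
    have hred : IsRedundant ({a, a⁻¹, b, b⁻¹} : Finset G) := by
      refine ⟨havoid _ hsq _ (one_pow 2), ?_⟩
      simp only [Finset.forall_mem_insert, Finset.mem_singleton, forall_eq]
      exact ⟨⟨a ^ 2, havoid _ hsq _ ha22, ha2, hshare⟩,
        ⟨a ^ 2, havoid _ hsq _ ha22, ha2, hshare'⟩,
        ⟨b ^ 2, havoid _ hsq _ hb22, hb2, hshareb⟩,
        ⟨b ^ 2, havoid _ hsq _ hb22, hb2, hshareb.mono_left (inv_mem (Subgroup.mem_zpowers b))⟩⟩
    have hcard : ({a, a⁻¹, b, b⁻¹} : Finset G).card = 4 := by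
      have h' : a ≠ b⁻¹ := fun h => hbai (by rw [h, inv_inv])
      rw [Finset.card_insert_of_notMem, Finset.card_insert_of_notMem,
        Finset.card_insert_of_notMem, Finset.card_singleton]
      · simpa using hbb
      · simpa using ⟨hbai.symm, hba.symm⟩
      · simpa using ⟨haa, hba.symm, h'⟩
    have := hS _ hred
    omega

/-- Four elements with nontrivial squares, pairwise neither equal nor inverse to each other, form a
redundant set. -/
lemma isRedundant_four [DecidableEq G] {a b c d : G} (ha : a ^ 2 ≠ 1) (hb : b ^ 2 ≠ 1)
    (hc : c ^ 2 ≠ 1) (hd : d ^ 2 ≠ 1) (hab : a ≠ b ∧ a ≠ b⁻¹) (hac : a ≠ c ∧ a ≠ c⁻¹)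
    (had : a ≠ d ∧ a ≠ d⁻¹) (hbc : b ≠ c ∧ b ≠ c⁻¹) (hbd : b ≠ d ∧ b ≠ d⁻¹)
    (hcd : c ≠ d ∧ c ≠ d⁻¹) :
    IsRedundant ({a, b, c, d} : Finset G) ∧ ({a, b, c, d} : Finset G).card = 4 := by
  have h1 : ∀ z : G, z ^ 2 ≠ 1 → z ≠ 1 := by rintro z hz rfl; simp at hz
  have hs : ∀ {y z : G}, y ≠ z⁻¹ → y⁻¹ ≠ z := fun h h' => h (by rw [← h', inv_inv])
  have hs' : ∀ {y z : G}, y ≠ z⁻¹ → z⁻¹ ≠ y := fun h => h.symm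
  have hself : ∀ {z : G}, z ^ 2 ≠ 1 → z⁻¹ ≠ z := fun h => (ne_inv_iff_sq_ne_one.2 h).symm
  refine ⟨isRedundant_of_inv_notMem ?_ ?_, ?_⟩
  · simp [(h1 a ha).symm, (h1 b hb).symm, (h1 c hc).symm, (h1 d hd).symm]
  · rw [Finset.forall_mem_insert, Finset.forall_mem_insert, Finset.forall_mem_insert]
    simp only [Finset.mem_singleton, forall_eq, Finset.mem_insert, not_or]
    exact ⟨⟨hself ha, hs hab.2, hs hac.2, hs had.2⟩, ⟨hs' hab.2, hself hb, hs hbc.2, hs hbd.2⟩,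
      ⟨hs' hac.2, hs' hbc.2, hself hc, hs hcd.2⟩, ⟨hs' had.2, hs' hbd.2, hs' hcd.2, hself hd⟩⟩
  · rw [Finset.card_insert_of_notMem, Finset.card_insert_of_notMem,
      Finset.card_insert_of_notMem, Finset.card_singleton]
    · simpa using hcd.1
    · simpa using ⟨hbc.1, hbd.1⟩
    · simpa using ⟨hab.1, hac.1, had.1⟩

/-- A group with elements of order `1`, `2` and `3` only in which redundant sets have at most three
elements has at most one subgroup of order `3`: if `⟨a⟩ ≠ ⟨b⟩`, then `a` either centralizes
`b` and `⟨a, b⟩` contains four such subgroups, or moves `⟨b⟩` in an orbit of length three. -/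
lemma isDihedralLike_three [Finite G] (hG : ¬ IsCyclic G)
    (hS : ∀ S : Finset G, IsRedundant S → S.card ≤ 3)
    (h4 : ∀ x : G, orderOf x ≤ 3) {a : G} (ha : orderOf a = 3) : IsDihedralLike G 3 := by
  classical
  have ha3 : a ^ 3 = 1 := ha ▸ pow_orderOf_eq_one a
  have ha2 : a ^ 2 ≠ 1 := sq_ne_one_of_three_le_orderOf (by omega)
  refine ⟨a, ha, ?_, fun b hb => ?_⟩
  · by_contra! h
    exact hG ⟨a, h⟩
  by_contra hb2
  have hob : orderOf b = 3 := le_antisymm (h4 b) (three_le_orderOf_of_sq_ne_one hb2)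
  have hb3 : b ^ 3 = 1 := hob ▸ pow_orderOf_eq_one b
  have hma := Subgroup.mem_zpowers a
  have hne : ∀ {y}, y ∉ Subgroup.zpowers a → a ≠ y ∧ a ≠ y⁻¹ := fun {y} hy =>
    ⟨by rintro rfl; exact hy (Subgroup.mem_zpowers _),
      fun h => hy (by rw [← inv_mem_iff, ← h]; exact hma)⟩
  -- conjugation by `a` as an automorphism
  let φ : G ≃* G := MulAut.conj a
  have hφ : ∀ y, φ y = a * y * a⁻¹ := fun y => rfl
  have hφ3 : ∀ y, φ (φ (φ y)) = y := by
    intro y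
    have : φ (φ (φ y)) = a ^ 3 * y * (a ^ 3)⁻¹ := by
      simp [hφ, pow_succ, mul_assoc]
    rw [this, ha3]; simp
  have hφa : ∀ y, y ∉ Subgroup.zpowers a → φ y ∉ Subgroup.zpowers a := by
    intro y hy h
    rw [hφ, Subgroup.mul_mem_cancel_right _ (inv_mem hma), Subgroup.mul_mem_cancel_left _ hma] at h
    exact hy h
  have hφ2 : ∀ y, y ^ 2 ≠ 1 → φ y ^ 2 ≠ 1 := by
    intro y hy
    rwa [← map_pow, ne_eq, MulEquiv.map_eq_one_iff]
  have hbinv : φ b ≠ b⁻¹ := by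
    intro h
    have := hφ3 b
    rw [h, map_inv, h, inv_inv, h] at this
    exact ne_inv_iff_sq_ne_one.2 hb2 this.symm
  by_cases hcomm : φ b = b
  · have hc : Commute a b := by rwa [hφ, mul_inv_eq_iff_eq_mul] at hcomm
    have hsq : ∀ z, z ∉ Subgroup.zpowers a → Commute a z → z ^ 3 = 1 → (a * z) ^ 2 ≠ 1 := by
      intro z hz hcz hz3 h
      rw [hcz.mul_pow] at h
      have hz2 : z ^ 2 ∈ Subgroup.zpowers a := by
        rw [← inv_mem_iff, ← eq_inv_of_mul_eq_one_left h]
        exact pow_mem hma 2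
      have : z = (z ^ 2)⁻¹ := by rw [eq_inv_iff_mul_eq_one, ← pow_succ', hz3]
      exact hz (this ▸ inv_mem hz2)
    have hbi : b⁻¹ ∉ Subgroup.zpowers a := by simpa using hb
    have ha1 : a ≠ 1 := by rintro rfl; simp at ha2
    have hbb : b⁻¹ * b⁻¹ = b := by
      have : b⁻¹ * b⁻¹ = b * (b ^ 3)⁻¹ := by group
      rw [this, hb3]; simp
    suffices hfour : IsRedundant ({a, b, a * b, a * b⁻¹} : Finset G) ∧
        ({a, b, a * b, a * b⁻¹} : Finset G).card = 4 by
      have := hS _ hfour.1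
      omega
    refine isRedundant_four ha2 hb2
      (hsq b hb hc hb3) (hsq _ hbi hc.inv_right (by rw [inv_pow, hb3, inv_one])) (hne hb)
      (hne fun h => hb ((Subgroup.mul_mem_cancel_left _ hma).1 h))
      (hne fun h => hbi ((Subgroup.mul_mem_cancel_left _ hma).1 h))
      ⟨by simpa using ha1, fun h => (hne hb).1 ?_⟩ ⟨fun h => (hne hb).2 ?_, fun h => ha1 ?_⟩
      ⟨fun h => ?_, fun h => ?_⟩
    · rw [← hbb, eq_mul_inv_iff_mul_eq]
      exact inv_eq_iff_eq_inv.1 h.symm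
    · rw [eq_mul_inv_iff_mul_eq] at h
      rw [← h, eq_inv_iff_mul_eq_one, ← pow_three', hb3]
    · rw [mul_inv_rev, inv_inv] at h
      simpa using h
    · exact ne_inv_iff_sq_ne_one.2 hb2 (mul_left_cancel h)
    · rw [mul_inv_rev, inv_inv, ← hc.inv_left.eq] at h
      exact ne_inv_iff_sq_ne_one.2 ha2 (mul_right_cancel h)
  · have hφb := hφa b hb
    suffices hfour : IsRedundant ({a, b, φ b, φ (φ b)} : Finset G) ∧
        ({a, b, φ b, φ (φ b)} : Finset G).card = 4 by
      have := hS _ hfour.1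
      omega
    refine isRedundant_four ha2 hb2
      (hφ2 b hb2) (hφ2 _ (hφ2 b hb2)) (hne hb) (hne hφb) (hne (hφa _ hφb))
      ⟨Ne.symm hcomm, fun h => hbinv (by rw [← inv_inv (φ b), ← h])⟩
      ⟨fun h => hcomm ?_, fun h => hbinv ?_⟩
      ⟨fun h => hcomm (φ.injective h).symm, fun h => hbinv ?_⟩
    · rw [h, hφ3, ← h]
    · have h' := congrArg φ h
      rwa [map_inv, hφ3] at h'
    · rw [← map_inv] at h
      exact inv_eq_iff_eq_inv.1 (φ.injective h).symm

/-- The case of redundant sets with at most three elements. -/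
lemma exists_isDihedralLike [Finite G] (hG : ¬ IsCyclic G)
    (hS : ∀ S : Finset G, IsRedundant S → S.card ≤ 3) :
    ∃ c, 2 ≤ c ∧ c ≤ 5 ∧ IsDihedralLike G c := by
  have h5 := orderOf_le_of_forall_isRedundant hS
  by_cases e5 : ∃ a : G, orderOf a = 5
  · obtain ⟨a, ha⟩ := e5
    exact ⟨5, by omega, by omega, isDihedralLike_of_orderOf_eq hG hS ha⟩
  push Not at e5
  have h4 : ∀ x : G, orderOf x ≤ 4 := fun x => by have := h5 x; have := e5 x; omega
  by_cases e4 : ∃ a : G, orderOf a = 4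
  · obtain ⟨a, ha⟩ := e4
    exact ⟨4, by omega, by omega, isDihedralLike_four hG hS h4 ha⟩
  push Not at e4
  have h3 : ∀ x : G, orderOf x ≤ 3 := fun x => by have := h4 x; have := e4 x; omega
  by_cases e3 : ∃ a : G, orderOf a = 3
  · obtain ⟨a, ha⟩ := e3
    exact ⟨3, by omega, by omega, isDihedralLike_three hG hS h3 ha⟩
  push Not at e3
  have hsq : ∀ x : G, x ^ 2 = 1 := fun x => by
    by_contra hx
    have := three_le_orderOf_of_sq_ne_one hx
    have := h3 x
    have := e3 x
    omega
  have hcomm : ∀ x y : G, x * y = y * x := fun x y => by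
    have hinv : ∀ z : G, z⁻¹ = z := fun z => by
      rw [inv_eq_iff_mul_eq_one, ← pow_two, hsq]
    rw [← hinv (x * y), mul_inv_rev, hinv, hinv]
  exact ⟨2, le_rfl, by omega, (isDihedralLike_two_iff hG).2 ⟨hcomm, hsq⟩⟩

end Redundant

/-! ### Counting elements by their order when no involution is maximal cyclic -/

section Count

variable (G : Type*) [Group G]

/-- The elements of order `2`. -/
def involutions : Set G := {x | orderOf x = 2}

/-- The elements of odd prime order. -/
def oddPrimeOrder : Set G := {x | (orderOf x).Prime ∧ orderOf x ≠ 2}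

/-- The nontrivial elements whose order is not prime. -/
def compositeOrder : Set G := {x | x ≠ 1 ∧ ¬ (orderOf x).Prime}

variable {G}

lemma ncard_involutions_add [Finite G] : 1 + (involutions G).ncard + (oddPrimeOrder G).ncard +
    (compositeOrder G).ncard = Nat.card G := by
  have hu : ({1} ∪ involutions G ∪ oddPrimeOrder G ∪ compositeOrder G) = Set.univ := by
    ext x
    simp only [involutions, oddPrimeOrder, compositeOrder, Set.mem_union, Set.mem_singleton_iff,
      Set.mem_ofPred_eq, Set.mem_univ, iff_true]
    tauto
  rw [← Set.ncard_univ, ← hu, Set.ncard_union_eq, Set.ncard_union_eq, Set.ncard_union_eq,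
    Set.ncard_singleton]
  · rw [Set.disjoint_left]
    rintro x rfl h
    simp [involutions] at h
  · rw [Set.disjoint_left]
    rintro x (rfl | h) ⟨h1, h2⟩
    · simp [Nat.not_prime_one] at h1
    · exact h2 h
  · rw [Set.disjoint_left]
    rintro x ((rfl | h) | h) ⟨h1, h2⟩
    · exact h1 rfl
    · exact h2 ((show orderOf x = 2 from h) ▸ Nat.prime_two)
    · exact h2 h.1

/-- Each involution is a power of some `w` of composite order; the elements `w` and `w⁻¹` so
obtained are different for different involutions. -/
lemma two_mul_ncard_involutions_le [Finite G]
    (h2 : ∀ z : G, orderOf z = 2 → ¬ IsMaximalCyclic z) :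
    2 * (involutions G).ncard ≤ (compositeOrder G).ncard := by
  have hex : ∀ z ∈ involutions G, ∃ w ∈ compositeOrder G, z ∈ Subgroup.zpowers w := by
    intro z hz
    have hz : orderOf z = 2 := hz
    obtain ⟨w, hw, hzw⟩ := exists_isMaximalCyclic z
    refine ⟨w, ⟨?_, fun hp => ?_⟩, hzw⟩
    · rintro rfl
      have : z = 1 := by simpa using hzw
      simp [this] at hz
    · have hd := orderOf_dvd_of_mem_zpowers hzw
      rw [hz, Nat.prime_dvd_prime_iff_eq Nat.prime_two hp] at hd
      have heq : Subgroup.zpowers z = Subgroup.zpowers w :=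
        Subgroup.eq_of_le_of_card_ge (Subgroup.zpowers_le.2 hzw)
          (by rw [Nat.card_zpowers, Nat.card_zpowers, hz, ← hd])
      refine h2 z hz fun y hy => ?_
      rw [heq]
      exact hw y (hy.mono_left (heq ▸ Subgroup.mem_zpowers w))
  choose! w hwA hzw using hex
  have hne : ∀ z ∈ involutions G, z ≠ 1 ∧ z ^ 2 = 1 := by
    intro z hz
    have hz : orderOf z = 2 := hz
    exact ⟨by rintro rfl; simp at hz, hz ▸ pow_orderOf_eq_one z⟩
  have hinj : ∀ z ∈ involutions G, ∀ z' ∈ involutions G,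
      w z ∈ Subgroup.zpowers (w z') → z = z' := by
    intro z hz z' hz' h
    have hs : ShareCyclic z z' := ⟨w z', (Subgroup.zpowers_le.2 h) (hzw z hz), hzw z' hz'⟩
    exact hs.eq_of_sq_eq_one (hne z hz).1 (hne z' hz').1 (hne z hz).2 (hne z' hz').2
  have hinjw : Set.InjOn w (involutions G) := fun z hz z' hz' h =>
    hinj z hz z' hz' (h ▸ Subgroup.mem_zpowers _)
  have hdisj : Disjoint (w '' involutions G) ((w '' involutions G).image Inv.inv) := by
    rw [Set.disjoint_left]
    rintro _ ⟨z, hz, rfl⟩ ⟨_, ⟨z', hz', rfl⟩, h⟩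
    have := hinj z hz z' hz' (h ▸ inv_mem (Subgroup.mem_zpowers _))
    subst this
    obtain ⟨hw1, hw2⟩ := hwA z hz
    have hsq : w z ^ 2 = 1 := by
      rw [pow_two, mul_eq_one_iff_inv_eq]; exact h
    exact hw2 (orderOf_eq_prime hsq hw1 ▸ Nat.prime_two)
  have hsub : w '' involutions G ∪ (w '' involutions G).image Inv.inv ⊆ compositeOrder G := by
    rintro _ (⟨z, hz, rfl⟩ | ⟨_, ⟨z, hz, rfl⟩, rfl⟩)
    · exact hwA z hz
    · obtain ⟨hw1, hw2⟩ := hwA z hz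
      exact ⟨by simpa using hw1, by rwa [orderOf_inv]⟩
  have := Set.ncard_le_ncard hsub (Set.toFinite _)
  rw [Set.ncard_union_eq hdisj, Set.ncard_image_of_injective _ inv_injective,
    hinjw.ncard_image] at this
  omega

/-- All elements of composite order, together with one element of each pair `{x, x⁻¹}` of elements
of odd prime order, form a redundant set. -/
lemma exists_isRedundant_two_mul_card [Finite G] : ∃ S : Finset G, IsRedundant S ∧
    2 * S.card = 2 * (compositeOrder G).ncard + (oddPrimeOrder G).ncard := by
  classical
  -- an auxiliary linear ordering of `G` picks one element out of each pair
  let f : G → ℕ := fun x => (Finite.equivFin G x : ℕ)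
  have hf : Function.Injective f := Fin.val_injective.comp (Finite.equivFin G).injective
  let P : Set G := {x | x ∈ oddPrimeOrder G ∧ f x < f x⁻¹}
  have hinvmem : ∀ x : G, x⁻¹ ∈ oddPrimeOrder G ↔ x ∈ oddPrimeOrder G := fun x => by
    simp [oddPrimeOrder]
  have hB : P ∪ P.image Inv.inv = oddPrimeOrder G := by
    ext x
    constructor
    · rintro (⟨hx, -⟩ | ⟨y, ⟨hy, -⟩, rfl⟩)
      · exact hx
      · exact (hinvmem y).2 hy
    · intro hx
      have hne : x ≠ x⁻¹ := by
        rw [ne_inv_iff_sq_ne_one]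
        intro h
        exact hx.2 (orderOf_eq_prime h (by
          rintro rfl; simp [oddPrimeOrder, Nat.not_prime_one] at hx))
      rcases lt_or_gt_of_ne (hf.ne hne) with h | h
      · exact Or.inl ⟨hx, h⟩
      · exact Or.inr ⟨x⁻¹, ⟨(hinvmem x).2 hx, by simpa using h⟩, inv_inv x⟩
  have hdisj : Disjoint P (P.image Inv.inv) := by
    rw [Set.disjoint_left]
    rintro _ ⟨-, h1⟩ ⟨y, ⟨-, h2⟩, rfl⟩
    simp only [inv_inv] at h1
    exact lt_asymm h1 h2
  have hBcard : (oddPrimeOrder G).ncard = 2 * P.ncard := by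
    rw [← hB, Set.ncard_union_eq hdisj, Set.ncard_image_of_injective _ inv_injective, two_mul]
  have hAP : Disjoint (compositeOrder G) P := by
    rw [Set.disjoint_left]
    exact fun x hx hx' => hx.2 hx'.1.1
  have hfin : (compositeOrder G ∪ P).Finite := Set.toFinite _
  refine ⟨hfin.toFinset, ⟨?_, fun x hx => ?_⟩, ?_⟩
  · simp only [Set.Finite.mem_toFinset]
    rintro (h | h)
    · exact h.1 rfl
    · simpa [Nat.not_prime_one] using h.1.1
  · simp only [Set.Finite.mem_toFinset] at hx ⊢
    have hxinv : ∀ y, (orderOf y).Prime → ∃ z, (z = y ∨ z = y⁻¹) ∧ z ∉ compositeOrder G ∪ P := by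
      intro y hy
      by_cases h : f y < f y⁻¹
      · refine ⟨y⁻¹, Or.inr rfl, ?_⟩
        rintro (h' | h')
        · exact h'.2 (by rwa [orderOf_inv])
        · have := h'.2
          rw [inv_inv] at this
          exact lt_asymm h this
      · refine ⟨y, Or.inl rfl, ?_⟩
        rintro (h' | h')
        · exact h'.2 hy
        · exact h h'.2
    have hx1 : x ≠ 1 := by
      rintro rfl
      rcases hx with h | h
      · exact h.1 rfl
      · simpa [Nat.not_prime_one] using h.1.1
    obtain ⟨p, hp, hpx⟩ := Nat.exists_prime_and_dvd (n := orderOf x) (by simpa using hx1)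
    have hoy : orderOf (x ^ (orderOf x / p)) = p :=
      orderOf_pow_orderOf_div (orderOf_pos x).ne' hpx
    obtain ⟨z, hz, hzS⟩ := hxinv (x ^ (orderOf x / p)) (by rwa [hoy])
    have hmem := Subgroup.npow_mem_zpowers x (orderOf x / p)
    have hy1 : x ^ (orderOf x / p) ≠ 1 := by
      intro h
      rw [h, orderOf_one] at hoy
      exact hp.one_lt.ne hoy
    refine ⟨z, hzS, ?_, .of_mem ?_⟩
    · rcases hz with rfl | rfl
      · exact hy1
      · simpa using hy1
    · rcases hz with rfl | rfl
      · exact hmem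
      · exact inv_mem hmem
  · rw [← Set.ncard_eq_toFinset_card _ hfin, Set.ncard_union_eq hAP, hBcard]
    ring

lemma two_mul_card_add_ncard_le [Finite G] {k : ℕ}
    (hS : ∀ S : Finset G, IsRedundant S → S.card ≤ k)
    (h2 : ∀ z : G, orderOf z = 2 → ¬ IsMaximalCyclic z) :
    2 * Nat.card G + (compositeOrder G).ncard ≤ 4 * k + 2 := by
  have h3 := ncard_involutions_add (G := G)
  have h4 := two_mul_ncard_involutions_le h2
  obtain ⟨S, hSr, hSc⟩ := exists_isRedundant_two_mul_card (G := G)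
  have := hS S hSr
  omega

lemma card_eq_nine [Finite G] (hG : ¬ IsCyclic G) (hS : ∀ S : Finset G, IsRedundant S → S.card ≤ 4)
    (h2 : ∀ z : G, orderOf z = 2 → ¬ IsMaximalCyclic z) :
    Nat.card G = 9 ∧ ∀ x : G, x ^ 3 = 1 := by
  have h := two_mul_card_add_ncard_le hS h2
  have h3 := ncard_involutions_add (G := G)
  have h4 := two_mul_ncard_involutions_le h2
  have hlt : ∀ x : G, orderOf x < Nat.card G := fun x => by
    by_contra! hx
    exact hG (isCyclic_of_card_le_orderOf x hx)
  have hprime : ¬ (Nat.card G).Prime := fun hp => by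
    have := Fact.mk hp
    exact hG (isCyclic_of_prime_card rfl)
  have hn1 : Nat.card G ≠ 1 := fun h1 => by
    have := hlt 1
    simp [h1] at this
  have hdvd : ∀ x : G, orderOf x ∣ Nat.card G := orderOf_dvd_natCard
  -- An element of composite order would leave only the order `8`; then no element has odd prime
  -- order, and the bounds on the remaining classes allow fewer than `8` elements.
  have hA : (compositeOrder G).ncard = 0 := by
    by_contra hA
    obtain ⟨w, hw1, hw2⟩ := Set.nonempty_of_ncard_ne_zero hA
    have hw := hdvd w
    have hwl := hlt w
    have hw1 : orderOf w ≠ 1 := by simpa using hw1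
    have hn : Nat.card G = 8 := by
      obtain ⟨m, hm⟩ := hw
      have h0 := orderOf_pos w
      have h9 : Nat.card G ≤ 8 := by omega
      have hw4 : 4 ≤ orderOf w := by
        by_contra! h'
        interval_cases orderOf w
        · exact hw1 rfl
        · exact hw2 Nat.prime_two
        · exact hw2 Nat.prime_three
      have hm2 : 2 ≤ m := by
        by_contra! h'
        interval_cases m <;> omega
      nlinarith
    have hB : (oddPrimeOrder G).ncard = 0 := by
      rw [Set.ncard_eq_zero, Set.eq_empty_iff_forall_notMem]
      rintro x ⟨hp, hx2⟩
      have hx := hdvd x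
      rw [hn, show 8 = 2 ^ 3 by norm_num] at hx
      exact hx2 ((Nat.prime_dvd_prime_iff_eq hp Nat.prime_two).1 (hp.dvd_of_dvd_pow hx))
    omega
  have hT : ¬ 2 ∣ Nat.card G := by
    intro hd
    have := Fact.mk Nat.prime_two
    obtain ⟨x, hx⟩ := exists_prime_orderOf_dvd_card' 2 hd
    have : (involutions G).ncard ≠ 0 := Set.ncard_ne_zero_of_mem (show x ∈ involutions G from hx)
    omega
  have hn : Nat.card G = 9 := by
    have h9 : Nat.card G ≤ 9 := by omega
    have h0 : 0 < Nat.card G := Nat.card_pos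
    generalize Nat.card G = n at *
    interval_cases n <;> first | rfl | omega | (exact absurd (by norm_num) hprime)
  refine ⟨hn, fun x => ?_⟩
  have hx := hdvd x
  have hxl := hlt x
  rw [hn] at hx hxl
  rw [← orderOf_dvd_iff_pow_eq_one]
  rw [show 9 = 3 ^ 2 by norm_num, Nat.dvd_prime_pow Nat.prime_three] at hx
  obtain ⟨m, hm, hx⟩ := hx
  interval_cases m <;> simp_all

end Count

/-! ### The elementary abelian group of order nine -/

section ExponentThree

variable {G : Type*} [Group G]

lemma orderOf_eq_three (h3 : ∀ x : G, x ^ 3 = 1) {x : G} (hx : x ≠ 1) : orderOf x = 3 :=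
  orderOf_eq_prime (h3 x) hx

lemma ShareCyclic.eq_or_eq_inv [Finite G] (h3 : ∀ x : G, x ^ 3 = 1) {x y : G} (hx : x ≠ 1)
    (hy : y ≠ 1) (h : ShareCyclic x y) : x = y ∨ x = y⁻¹ := by
  obtain ⟨g, hxg, hyg⟩ := h
  have hg : g ≠ 1 := by rintro rfl; exact hx (by simpa using hxg)
  have heq : Subgroup.zpowers y = Subgroup.zpowers g :=
    Subgroup.eq_of_le_of_card_ge (Subgroup.zpowers_le.2 hyg) (by
      rw [Nat.card_zpowers, Nat.card_zpowers, orderOf_eq_three h3 hg, orderOf_eq_three h3 hy])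
  rw [← heq, ← mem_powers_iff_mem_zpowers] at hxg
  obtain ⟨k, rfl⟩ := hxg
  simp only at hx ⊢
  rw [← pow_mod_orderOf, orderOf_eq_three h3 hy] at hx ⊢
  have hk := Nat.mod_lt k three_pos
  interval_cases k % 3
  · simp at hx
  · simp
  · right
    rw [eq_inv_iff_mul_eq_one, ← pow_succ, h3]

lemma dominationNumber_add_of_card_eq_nine [Finite G] (hC : cyclicizer G = {1})
    (h9 : Nat.card G = 9) (h3 : ∀ x : G, x ^ 3 = 1) :
    dominationNumber (nonCyclicGraph G) + dominationNumber (nonCyclicGraph G)ᶜ = 6 := by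
  classical
  have : Nontrivial G := Finite.one_lt_card_iff_nontrivial.1 (by omega)
  have hinv : ∀ x : G, x ≠ 1 → x⁻¹ ≠ x := fun x hx => (ne_inv_iff_sq_ne_one.2
    (sq_ne_one_of_three_le_orderOf (orderOf_eq_three h3 hx).ge)).symm
  have hle : dominationNumber (nonCyclicGraph G) ≤ 2 := by
    obtain ⟨g, hg⟩ := exists_ne (1 : G)
    obtain ⟨x, hx, hgx⟩ := exists_isMaximalCyclic g
    have hx1 : x ≠ 1 := by rintro rfl; exact hg (by simpa using hgx)
    have := hx.dominationNumber_le hC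
    rwa [orderOf_eq_three h3 hx1, Nat.prime_three.primeFactors, Finset.card_singleton] at this
  have hge : 2 ≤ dominationNumber (nonCyclicGraph G) := by
    have h1 := one_le_dominationNumber hC (nonCyclicGraph G)
    by_contra! h2
    obtain ⟨D, hD, hcard⟩ := exists_card_eq_dominationNumber (nonCyclicGraph G)
    obtain ⟨u, rfl⟩ := Finset.card_eq_one.1 (hcard.trans (by omega))
    have hu := (notMem_cyclicizer_iff hC).1 u.2
    obtain ⟨w, hw, ha⟩ := hD ⟨u.1⁻¹, (notMem_cyclicizer_iff hC).2 (by simpa using hu)⟩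
      (by simpa [Subtype.ext_iff] using hinv _ hu)
    obtain rfl : w = u := by simpa using hw
    exact nonCyclicGraph_adj.1 ha (shareCyclic_inv_right _).symm
  have hcle : dominationNumber (nonCyclicGraph G)ᶜ ≤ 4 := by
    obtain ⟨S, hS, hcard⟩ := exists_isRedundant_two_mul_card (G := G)
    have h := hS.card_add_dominationNumber_le hC
    have hn := ncard_involutions_add (G := G)
    have hT : (involutions G).ncard = 0 := by
      rw [Set.ncard_eq_zero, Set.eq_empty_iff_forall_notMem]
      intro x hx
      have hx : orderOf x = 2 := hx
      rw [orderOf_eq_three h3 (by rintro rfl; simp at hx)] at hx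
      omega
    omega
  have hcge : 4 ≤ dominationNumber (nonCyclicGraph G)ᶜ := by
    obtain ⟨D, hD, hcard⟩ := exists_card_eq_dominationNumber (nonCyclicGraph G)ᶜ
    -- a vertex dominates only itself and its inverse
    have hsub : (Set.univ : Set G) ⊆
        ((insert 1 (D.image Subtype.val ∪ D.image fun u => u.1⁻¹) : Finset G) : Set G) := by
      intro x _
      by_cases hx : x = 1
      · simp [hx]
      let v : {x : G // x ∉ cyclicizer G} := ⟨x, (notMem_cyclicizer_iff hC).2 hx⟩
      simp only [Finset.coe_insert, Finset.coe_union, Finset.coe_image]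
      right
      by_cases hv : v ∈ D
      · exact Or.inl ⟨v, hv, rfl⟩
      · obtain ⟨u, hu, ha⟩ := hD v (by simpa using hv)
        obtain ⟨-, hs⟩ := compl_nonCyclicGraph_adj.1 ha
        rcases hs.eq_or_eq_inv h3 hx ((notMem_cyclicizer_iff hC).1 u.2) with h | h
        · exact Or.inl ⟨u, hu, h.symm⟩
        · exact Or.inr ⟨u, hu, h.symm⟩
    have h := Set.ncard_le_ncard hsub (Set.toFinite _)
    rw [Set.ncard_univ, h9, Set.ncard_coe_finset] at h
    have h1 := Finset.card_insert_le 1 (D.image Subtype.val ∪ D.image fun u => u.1⁻¹)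
    have h2 := Finset.card_union_le (D.image Subtype.val) (D.image fun u => u.1⁻¹)
    have h4 : (D.image Subtype.val).card ≤ D.card := Finset.card_image_le
    have h5 : (D.image fun u => u.1⁻¹).card ≤ D.card := Finset.card_image_le
    omega
  omega

/-- An abelian group of exponent `3` is a vector space over `ZMod 3`, and one of order `9` has
dimension two. -/
lemma card_eq_nine_and_iff [Finite G] : (Nat.card G = 9 ∧ ∀ x : G, x ^ 3 = 1) ↔
    Nonempty (G ≃* Multiplicative (ZMod 3 × ZMod 3)) := by
  constructor
  · rintro ⟨h9, h3⟩
    have : Fact (Nat.Prime 3) := ⟨Nat.prime_three⟩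
    let _ : CommGroup G := IsPGroup.commGroupOfCardEqPrimeSq (p := 3) (by simpa using h9)
    let _ : Module (ZMod 3) (Additive G) := AddCommGroup.zmodModule (n := 3) fun x => h3 x.toMul
    have hfin : Module.finrank (ZMod 3) (Additive G) = 2 := by
      have h := Module.natCard_eq_pow_finrank (K := ZMod 3) (V := Additive G)
      rw [Nat.card_zmod, Nat.card_congr Additive.toMul, h9, show 9 = 3 ^ 2 by norm_num] at h
      exact (Nat.pow_right_injective (by norm_num : 2 ≤ 3) h).symm
    have e : Additive G ≃ₗ[ZMod 3] ZMod 3 × ZMod 3 :=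
      LinearEquiv.ofFinrankEq _ _ (by rw [hfin, Module.finrank_prod, Module.finrank_self])
    exact ⟨AddEquiv.toMultiplicativeRight e.toAddEquiv⟩
  · rintro ⟨e⟩
    refine ⟨?_, fun x => e.injective ?_⟩
    · rw [Nat.card_congr e.toEquiv, Nat.card_congr Multiplicative.toAdd, Nat.card_prod,
        Nat.card_zmod]
    · rw [map_pow, map_one]
      generalize e x = y
      revert y
      decide

end ExponentThree

/-! ### The sum of the two domination numbers -/

lemma two_pow_card_primeFactors_le {c : ℕ} (hc : c ≠ 0) : 2 ^ c.primeFactors.card ≤ c :=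
  (Finset.pow_card_le_prod _ _ _ fun _ hp => (Nat.prime_of_mem_primeFactors hp).two_le).trans
    (Nat.le_of_dvd (Nat.pos_of_ne_zero hc) (Nat.prod_primeFactors_dvd c))

/-- If the sum of the two domination numbers is at least `|G| - 3`, then `G` is one of the groups
for which it has been computed. -/
lemma isDihedralLike_or_card_eq_nine {G : Type*} [Group G] [Finite G] (hG : ¬ IsCyclic G)
    (hC : cyclicizer G = {1})
    (h : Nat.card G ≤
      dominationNumber (nonCyclicGraph G) + dominationNumber (nonCyclicGraph G)ᶜ + 3) :
    (∃ c, 2 ≤ c ∧ c ≤ 5 ∧ IsDihedralLike G c) ∨ (Nat.card G = 9 ∧ ∀ x : G, x ^ 3 = 1) := by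
  have hS : ∀ S : Finset G, IsRedundant S → S.card ≤ dominationNumber (nonCyclicGraph G) + 2 :=
    fun S hS => by
      have := hS.card_add_dominationNumber_le hC
      omega
  by_cases hz : ∃ z : G, orderOf z = 2 ∧ IsMaximalCyclic z
  · obtain ⟨z, hz2, hz⟩ := hz
    rw [hz.dominationNumber_eq_one hC hz2] at hS
    exact Or.inl (exists_isDihedralLike hG hS)
  · push Not at hz
    right
    have : Nontrivial G := by
      by_contra h
      rw [not_nontrivial_iff_subsingleton] at h
      exact hG isCyclic_of_subsingleton
    obtain ⟨g, hg⟩ := exists_ne (1 : G)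
    obtain ⟨w, hw, hgw⟩ := exists_isMaximalCyclic g
    have hw1 : orderOf w ≠ 1 := by
      rw [ne_eq, orderOf_eq_one_iff]
      rintro rfl
      exact hg (by simpa using hgw)
    have hγ := hw.dominationNumber_le hC
    have hord := orderOf_le_of_forall_isRedundant hS w
    have hpow := two_pow_card_primeFactors_le (orderOf_pos w).ne'
    have h8 : orderOf w ≤ 8 := by
      have hω : (orderOf w).primeFactors.card ≤ 3 := by
        by_contra! hω
        have : ∀ m, 4 ≤ m → m + 5 < 2 ^ m := fun m hm => by
          induction m, hm using Nat.le_induction with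
          | base => norm_num
          | succ m hm ih => rw [pow_succ]; omega
        have := this _ hω
        omega
      omega
    have hω : (orderOf w).primeFactors.card ≤ 1 ∨
        (orderOf w = 6 ∧ (orderOf w).primeFactors.card ≤ 2) := by
      have h0 := orderOf_pos w
      have : ∀ c ∈ Finset.Icc 1 8, c.primeFactors.card ≤ 1 ∨ (c = 6 ∧ c.primeFactors.card ≤ 2) := by
        decide +kernel
      exact this _ (Finset.mem_Icc.2 ⟨h0, h8⟩)
    rcases hω with hω | ⟨h6, hω⟩
    · exact card_eq_nine hG (fun S hS' => (hS S hS').trans (by omega)) hz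
    · -- a group of order at most `11` with an element of order `6` is generated by it
      have hn := two_mul_card_add_ncard_le (k := 5) (fun S hS' => (hS S hS').trans (by omega)) hz
      obtain ⟨m, hm⟩ := orderOf_dvd_natCard w
      refine (hG (isCyclic_of_card_le_orderOf w ?_)).elim
      rw [h6] at hm ⊢
      omega

theorem theorem71 (G : Type*) [Group G] [Finite G] (n : ℕ) (hn : Nat.card G = n)
    (hG : ¬ LocallyCyclic G) (hCyc : Nat.card (cyclicizer G) = 1) :
    ((dominationNumber (nonCyclicGraph G) : ℤ) + (dominationNumber (nonCyclicGraph G)ᶜ : ℤ) = n ↔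
      IsElementaryAbelianTwoGroup G) ∧
    ((dominationNumber (nonCyclicGraph G) : ℤ) + (dominationNumber (nonCyclicGraph G)ᶜ : ℤ)
        = (n : ℤ) - 1 ↔
      Nonempty (G ≃* Equiv.Perm (Fin 3))) ∧
    ((dominationNumber (nonCyclicGraph G) : ℤ) + (dominationNumber (nonCyclicGraph G)ᶜ : ℤ)
        = (n : ℤ) - 2 ↔
      Nonempty (G ≃* DihedralGroup 4)) ∧
    ((dominationNumber (nonCyclicGraph G) : ℤ) + (dominationNumber (nonCyclicGraph G)ᶜ : ℤ)
        = (n : ℤ) - 3 ↔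
      (Nonempty (G ≃* DihedralGroup 5) ∨
        Nonempty (G ≃* Multiplicative (ZMod 3 × ZMod 3)))) := by
  have hcyc : ¬ IsCyclic G := fun _ => hG fun H _ => inferInstance
  have hC : cyclicizer G = {1} := by
    obtain ⟨x, hx⟩ := Set.ncard_eq_one.1 ((Nat.card_coe_set_eq _).symm.trans hCyc)
    have := one_mem_cyclicizer (G := G)
    rw [hx] at this ⊢
    rw [Set.mem_singleton_iff.1 this]
  rw [← isDihedralLike_two_iff hcyc, ← isDihedralLike_three_iff,
    ← isDihedralLike_iff_nonempty_mulEquiv (c := 4) (by omega),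
    ← isDihedralLike_iff_nonempty_mulEquiv (c := 5) (by omega), ← card_eq_nine_and_iff]
  have hmain := isDihedralLike_or_card_eq_nine hcyc hC
  have hdih := fun c hc => IsDihedralLike.dominationNumber_add (G := G) hC (c := c) hc
  have hnine := fun h : Nat.card G = 9 ∧ ∀ x : G, x ^ 3 = 1 =>
    dominationNumber_add_of_card_eq_nine hC h.1 h.2
  rw [hn] at hmain hdih hnine ⊢
  generalize dominationNumber (nonCyclicGraph G) = s at *
  generalize dominationNumber (nonCyclicGraph G)ᶜ = t at *
  -- each part: the structure theorem in one direction, the value of the sum in the other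
  have hiff : ∀ c, 2 ≤ c → c ≤ 5 → s + t + c = n + 2 →
      IsDihedralLike G c ∨ c = 5 ∧ n = 9 ∧ ∀ x : G, x ^ 3 = 1 := by
    intro c hc hc5 hst
    rcases hmain (by omega) with ⟨c', hc', -, h⟩ | h
    · have := hdih c' hc' h
      obtain rfl : c' = c := by omega
      exact Or.inl h
    · have := hnine h
      exact Or.inr ⟨by omega, h⟩
  refine ⟨⟨fun h => ?_, fun h => ?_⟩, ⟨fun h => ?_, fun h => ?_⟩, ⟨fun h => ?_, fun h => ?_⟩,
    ⟨fun h => ?_, ?_⟩⟩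
  · exact (hiff 2 (by omega) (by omega) (by omega)).resolve_right (by omega)
  · have := hdih 2 (by omega) h
    omega
  · exact (hiff 3 (by omega) (by omega) (by omega)).resolve_right (by omega)
  · have := hdih 3 (by omega) h
    omega
  · exact (hiff 4 (by omega) (by omega) (by omega)).resolve_right (by omega)
  · have := hdih 4 (by omega) h
    omega
  · exact (hiff 5 (by omega) (by omega) (by omega)).imp_right And.right
  · rintro (h | h)
    · have := hdih 5 (by omega) h
      omega
    · have := hnine h
      have := h.1
      omega
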